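/- Let $X$ be a finite undirected multigraph with vertex set $V$: a finite directed multigraph (multiple edges and loops allowed) with an involution $e\mapsto\bar e$ on its directed edges that exchanges origin and terminus. Let $A(X)_{uv}$ be the number of directed edges from $u$ to $v$, let $D(X)$ be the diagonal matrix whose entry at $u$ is the number of directed edges leaving $u$, and put $L(X)=-A(X)+D(X)$, $Q(X)=A(X)+D(X)$. For a square matrix $M$ write $\phi(M,x)=\det(xI-M)$. Let $\pi=\{V_1,\dots,V_r\}$ be an equitable partition of $V$: for all $i,j$ there is a number $b_{ij}$ such that every vertex of $V_i$ has exactly $b_{ij}$ edges to vertices of $V_j$. The quotient $X/\pi$ is the directed multigraph with vertices $V_1,\dots,V_r$ and $b_{ij}$ edges from $V_i$ to $V_j$; thus $A(X/\pi)=(b_{ij})$, and $D(X/\pi)$ is the diagonal matrix of its out-degrees $\sum_j b_{ij}$. Fix vertices $\bar v_i\in V_i$ ($i=1,\dots,r$), put $V'=V\setminus\{\bar v_1,\dots,\bar v_r\}$, $V_i'=V_i\setminus\{\bar v_i\}$, and let the deletion graph $X\setminus\pi$ be the signed directed graph $X|_{V'}-\sum_{i,j}\big(V_i'(\bar v_i)\triangleright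 V_j'\big)$ on $V'$, where $B(w)\triangleright C$ has $A(X)_{wv}$ edges from each $u\in B$ to each $v\in C$ and no others, and sums and differences are those of the adjacency matrices (extended by $0$). Thus $A(X\setminus\pi)_{uv}=A(X)_{uv}-A(X)_{\bar v_i v}$ for $u\in V_i'$, $v\in V'$. Then for all $\alpha,d_1,\dots,d_r\in\mathbb C$ and the diagonal matrix $D$ with $D|_{V_i\times V_i}=d_iI$ for all $i$, $$\phi(\alpha A(X)+D,x)=\phi\big(\alpha A(X/\pi)+(\delta_{ij}d_i),x\big)\cdot\phi\big(\alpha A(X\setminus\pi)+D|_{V'\times V'},x\big).$$ In particular: (a) $\phi(L(X),x)=\phi\big(-A(X/\pi)+D(X/\pi),x\big)\cdot\phi\big(-A(X\setminus\pi)+D(X)|_{V'\times V'},x\big)$ and $\phi(Q(X),x)=\phi\big(A(X/\pi)+D(X/\pi),x\big)\cdot\phi\big(A(X\setminus\pi)+D(X)|_{V'\times V'},x\big)$. (b) Suppose that $\bar e\ne e$ for every directed edge $e$. Let $n=\#V$, let $m$ be the number of non-oriented edges $\{e,\bar e\}$, and for $u,t\in\mathbb C$ let $s_1=1-(1-u)^2t^2$,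 $s_2=(1-u)t^2$, $D^Z(X)=s_1I+s_2D(X)$ and $D^Z(X/\pi)=s_1I+s_2D(X/\pi)$. Let $$Z_X(u,t)=\prod_{[C]}\frac1{1-u^{cbc(C)}t^{|C|}}$$ be the Ihara–Bartholdi zeta function. Here $[C]$ runs over the prime cycles, that is, the classes under cyclic permutation of the closed paths $C=(e_1,\dots,e_k)$, $k\ge1$ (the terminus of $e_i$ is the origin of $e_{i+1}$ for all $i\in\mathbb Z/k\mathbb Z$), that are not of the form $B^l$ with $l\ge2$; $|C|=k$; and $cbc(C)=\#\{i\in\mathbb Z/k\mathbb Z: e_{i+1}=\bar e_i\}$. For every $u\in\mathbb C$ this product converges absolutely (that is, $\sum_{[C]}|u^{cbc(C)}t^{|C|}|<\infty$) for all $t$ in a neighbourhood of $0$; and for all $u,t\in\mathbb C$ at which it converges absolutely and at which $s_1\neq0$ or $m\ge n$, $$Z_X(u,t)^{-1}=s_1^{m-n}\det\big(-tA(X/\pi)+D^Z(X/\pi)\big)\cdot\det\big(-tA(X\setminus\pi)+D^Z(X)|_{V'\times V'}\big),$$ where $Z_X(u,t)^{-1}=0$ if some factor $1-u^{cbc(C)}t^{|C|}$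 is $0$. -/

import Mathlib

open Filter Topology

/-- A directed multigraph with vertex set `V` and edge set `E`; multiple edges and multiple loops
are allowed. -/
structure MultiDigraph (V E : Type*) where
  /-- The origin of a directed edge. -/
  origin : E → V
  /-- The terminus of a directed edge. -/
  terminus : E → V

/-- A signed directed graph with vertex set `V`. It is determined by its integer adjacency matrix:
there are `adj u v` positive edges from `u` to `v` if `adj u v ≥ 0`, and `|adj u v|` negative
edges from `u` to `v` if `adj u v ≤ 0`. -/
structure SignedDigraph (V : Type*) where
  /-- The signed number of edges from one vertex to another. -/
  adj : Matrix V V ℤ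

namespace SignedDigraph

variable {V : Type*}

/-- The adjacency matrix of a signed directed graph, with entries in `R`. -/
def adjMatrix (Y : SignedDigraph V) (R : Type*) [Ring R] : Matrix V V R :=
  Y.adj.map (Int.cast : ℤ → R)

/-- The difference `Y₁ - Y₂` of two signed directed graphs. -/
def sub (Y₁ Y₂ : SignedDigraph V) : SignedDigraph V where
  adj := Y₁.adj - Y₂.adj

/-- The sum of a finite family of signed directed graphs. -/
def sum {κ : Type*} [Fintype κ] (Y : κ → SignedDigraph V) : SignedDigraph V where
  adj := ∑ k, (Y k).adj

end SignedDigraph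

namespace MultiDigraph

variable {V E ι : Type*}

section Matrices

variable [DecidableEq V] [Fintype E]

/-- The adjacency matrix `A(X)`: the entry at `(u, v)` is the number of edges from `u` to `v`. -/
def adjMatrix (X : MultiDigraph V E) (R : Type*) [Ring R] : Matrix V V R :=
  Matrix.of fun u v =>
    (((Finset.univ.filter fun e => X.origin e = u ∧ X.terminus e = v).card : ℕ) : R)

/-- The number of edges that go from `u`. -/
def degree (X : MultiDigraph V E) (u : V) : ℕ :=
  (Finset.univ.filter fun e => X.origin e = u).card

/-- The degree matrix `D(X)`. -/
def degMatrix (X : MultiDigraph V E) : Matrix V V ℂ :=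
  Matrix.diagonal fun u => (X.degree u : ℂ)

/-- The Laplacian matrix `L(X) = -A(X) + D(X)`. -/
def laplacian (X : MultiDigraph V E) : Matrix V V ℂ :=
  -X.adjMatrix ℂ + X.degMatrix

/-- The signless Laplacian matrix `Q(X) = A(X) + D(X)`. -/
def signlessLaplacian (X : MultiDigraph V E) : Matrix V V ℂ :=
  X.adjMatrix ℂ + X.degMatrix

/-- The matrix `D^Z(X) = s₁ I + s₂ D(X)`, where `s₁ = 1 - (1 - u)² t²` and `s₂ = (1 - u) t²`. -/
def zetaDegMatrix (X : MultiDigraph V E) (u t : ℂ) : Matrix V V ℂ :=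
  (1 - (1 - u) ^ 2 * t ^ 2) • (1 : Matrix V V ℂ) + ((1 - u) * t ^ 2) • X.degMatrix

/-- The graph `X` as a signed directed graph, all of whose edges are positive. -/
def toSigned (X : MultiDigraph V E) : SignedDigraph V where
  adj := X.adjMatrix ℤ

end Matrices

/-- The restriction of `X` to the vertices that satisfy `p`. -/
def restrict (X : MultiDigraph V E) (p : V → Prop) :
    MultiDigraph {v : V // p v} {e : E // p (X.origin e) ∧ p (X.terminus e)} where
  origin e := ⟨X.origin e, e.2.1⟩
  terminus e := ⟨X.terminus e, e.2.2⟩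

section Quotient

variable [DecidableEq V] [Fintype E] [DecidableEq ι]

/-- An indexed partition of `V` with cells `V_i = {v | c v = i}` is equitable if for all `i`, `j`
there is a number `b_ij` such that every vertex of `V_i` has exactly `b_ij` edges to vertices
of `V_j`. -/
def IsEquitable (X : MultiDigraph V E) (c : V → ι) : Prop :=
  ∀ i j : ι, ∃ b : ℕ, ∀ u : V, c u = i →
    (Finset.univ.filter fun e => X.origin e = u ∧ c (X.terminus e) = j).card = b

/-- The number `b_ij` of edges from a vertex of the cell `V_i` to the cell `V_j`
(it is unique, as the cells of a partition are nonempty). -/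
noncomputable def IsEquitable.edgeCount {X : MultiDigraph V E} {c : V → ι}
    (h : X.IsEquitable c) (i j : ι) : ℕ :=
  (h i j).choose

/-- The quotient `X/π`: its vertices are the cells, and there are `b_ij` edges from `V_i`
to `V_j`. -/
def quotientGraph {X : MultiDigraph V E} {c : V → ι} (h : X.IsEquitable c) :
    MultiDigraph ι (Σ i : ι, Σ j : ι, Fin (h.edgeCount i j)) where
  origin e := e.1
  terminus e := e.2.1

end Quotient

/-- The set `V'` of the vertices that are not among the deleting vertices `w i`. -/
abbrev Remaining (w : ι → V) : Type _ := {v : V // ∀ i, v ≠ w i}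

section Deletion

variable [Fintype V] [DecidableEq V] [Fintype E] [Fintype ι] [DecidableEq ι]

/-- The part `V_i' = V_i \ {w i}` of the cell `V_i` that remains. -/
def remainingCell (c : V → ι) (w : ι → V) (i : ι) : Finset (Remaining w) :=
  Finset.univ.filter fun v => c v.1 = i

/-- The signed directed graph `B(a) ▷ C` for a vertex `a` of `X` and `B, C ⊆ V'`: every vertex of
`B` gets as many edges to `v ∈ C` as `a` has in `X`. It is extended by zero to all of `V'`. -/
def bundle (X : MultiDigraph V E) (w : ι → V) (B : Finset (Remaining w)) (a : V)
    (C : Finset (Remaining w)) : SignedDigraph (Remaining w) where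
  adj := Matrix.of fun u v => if u ∈ B ∧ v ∈ C then X.adjMatrix ℤ a v.1 else 0

/-- The deletion graph `X∖π = X|_{V'} - ∑_{i,j} V_i'(w i) ▷ V_j'`, where `V'` consists of the
vertices other than the deleting vertices `w i ∈ V_i`. -/
def deletionGraph (X : MultiDigraph V E) (c : V → ι) (w : ι → V) :
    SignedDigraph (Remaining w) :=
  (X.restrict fun v => ∀ i, v ≠ w i).toSigned.sub
    (SignedDigraph.sum fun p : ι × ι =>
      X.bundle w (remainingCell c w p.1) (w p.1) (remainingCell c w p.2))

end Deletion

end MultiDigraph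

/-- The restriction of a matrix to `V' × V'`. -/
def Matrix.restrictRemaining {V ι : Type*} (M : Matrix V V ℂ) (w : ι → V) :
    Matrix (MultiDigraph.Remaining w) (MultiDigraph.Remaining w) ℂ :=
  M.submatrix Subtype.val Subtype.val

/-- An undirected multigraph: a directed multigraph in which every edge `e` has an inverse edge. -/
structure UndirectedMultigraph (V E : Type*) extends MultiDigraph V E where
  /-- The inverse edge. -/
  inv : E → E
  inv_inv : ∀ e, inv (inv e) = e
  origin_inv : ∀ e, origin (inv e) = terminus e

namespace UndirectedMultigraph

variable {V E : Type*}

/-- The number of non-oriented edges `{e, inv e}`. -/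
noncomputable def numEdges (X : UndirectedMultigraph V E) : ℕ :=
  (Set.range fun e : E => s(e, X.inv e)).ncard

/-- The pairs `(e_i, e_{i+1})`, `i ∈ ℤ/k`, of cyclically consecutive entries
of `C = (e_1, …, e_k)`. -/
def cyclicPairs (C : List E) : List (E × E) := C.zip (C.rotate 1)

/-- A closed path is a nonempty sequence `(e_1, …, e_k)` of edges in which the terminus of `e_i` is
the origin of `e_{i+1}` for all `i ∈ ℤ/k`. -/
def IsClosedPath (X : UndirectedMultigraph V E) (C : List E) : Prop :=
  C ≠ [] ∧ ∀ p ∈ cyclicPairs C, X.terminus p.1 = X.origin p.2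

/-- The cyclic bump count of `(e_1, …, e_k)`: the number of `i ∈ ℤ/k` such that `e_{i+1}` is
the inverse of `e_i`. -/
def cyclicBumpCount [DecidableEq E] (X : UndirectedMultigraph V E) (C : List E) : ℕ :=
  (cyclicPairs C).countP fun p => decide (p.2 = X.inv p.1)

theorem cyclicBumpCount_eq_of_isRotated [DecidableEq E] (X : UndirectedMultigraph V E)
    {C C' : List E} (h : C ~r C') : X.cyclicBumpCount C = X.cyclicBumpCount C' := by
  obtain ⟨n, rfl⟩ := h
  have key : cyclicPairs (C.rotate n) = (cyclicPairs C).rotate n := by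
    unfold cyclicPairs
    rw [List.rotate_rotate, Nat.add_comm, ← List.rotate_rotate]
    exact (List.zipWith_rotate_distrib Prod.mk _ _ _ (by simp)).symm
  unfold cyclicBumpCount
  rw [key]
  exact ((List.rotate_perm _ n).countP_eq _).symm

/-- A prime cycle: a class of closed paths under cyclic permutation, none of whose representatives
is a power `B ^ k` with `k ≥ 2`. -/
def PrimeCycle (X : UndirectedMultigraph V E) : Type _ :=
  {z : Cycle E // ∀ C : List E, (C : Cycle E) = z →
    X.IsClosedPath C ∧ ∀ (B : List E) (k : ℕ), 2 ≤ k → C ≠ (List.replicate k B).flatten}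

namespace PrimeCycle

/-- The length of a prime cycle. -/
def length {X : UndirectedMultigraph V E} (z : X.PrimeCycle) : ℕ := z.1.length

/-- The cyclic bump count of a prime cycle. -/
def cbc [DecidableEq E] {X : UndirectedMultigraph V E} (z : X.PrimeCycle) : ℕ :=
  Quotient.lift (s := List.IsRotated.setoid E) X.cyclicBumpCount
    (fun _ _ h => X.cyclicBumpCount_eq_of_isRotated h) z.1

end PrimeCycle

section Zeta

variable [DecidableEq E]

/-- The Ihara-Bartholdi zeta function `Z_X(u, t) = ∏_{[C]} 1 / (1 - u^{cbc C} t^{|C|})`, the product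
being over all prime cycles of `X`. -/
noncomputable def zeta (X : UndirectedMultigraph V E) (u t : ℂ) : ℂ :=
  ∏' z : X.PrimeCycle, (1 - u ^ z.cbc * t ^ z.length)⁻¹

/-- The Euler product of `Z_X` converges absolutely at `(u, t)`. -/
def ZetaConverges (X : UndirectedMultigraph V E) (u t : ℂ) : Prop :=
  Summable fun z : X.PrimeCycle => ‖u ^ z.cbc * t ^ z.length‖

end Zeta

end UndirectedMultigraph

/-! The factorization of characteristic polynomials is a block triangularization. If the row sums of
`M` over the cells depend only on the cell of the row, the indicator vectors of the cells span an
`M`-invariant subspace on which `M` acts by the quotient matrix. In the basis of these indicators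
and the unit vectors at the remaining vertices, the other diagonal block is `M u v - M (w (c u)) v`,
which is the deletion matrix (`charpoly_eq_mul_of_cells`). Degrees are constant on cells, so `L`,
`Q` and the zeta matrices are covered.

For the zeta function, let the edge matrix have an entry `t` for consecutive edges, or `u * t` for
an edge followed by its inverse. Where the Euler product converges absolutely, it equals `det (1 -
edgeMatrix)` (`tprod_eq_det`): near the origin take logarithms, expand them in traces of powers, and
use that every closed path is uniquely a power of a primitive one; elsewhere continue analytically
in a scaling parameter. Sylvester's determinant identity then passes from edges to vertices
(`det_one_sub_edgeMatrix`), and the factorization applies to the resulting matrix. -/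

namespace Matrix

/-! ### Eigenvalues, traces of powers and determinants -/

open Polynomial

variable {n : Type*} [Fintype n] [DecidableEq n]

/-- Both sides are multiplicative in `p`, which splits over `ℂ`. For a linear factor the sign in
`det (M - a) = ± charpoly a` is absorbed because there are as many roots as rows. -/
theorem det_aeval_eq_prod_roots (M : Matrix n n ℂ) (p : ℂ[X]) :
    (aeval M p).det = (M.charpoly.roots.map fun a => p.eval a).prod := by
  have lin (a : ℂ) : (M - algebraMap ℂ _ a).det =
      (M.charpoly.roots.map fun b => b - a).prod := by
    have h := (IsAlgClosed.splits M.charpoly).eval_eq_prod_roots_of_monic M.charpoly_monic a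
    rw [eval_charpoly] at h
    have hc : M.charpoly.roots.card = Fintype.card n := by
      rw [← (IsAlgClosed.splits M.charpoly).natDegree_eq_card_roots, charpoly_natDegree_eq_dim]
    have e : M - algebraMap ℂ _ a = -(scalar n a - M) := by
      rw [neg_sub]; rfl
    rw [e, det_neg, h, ← hc]
    induction M.charpoly.roots using Multiset.induction_on with
    | empty => simp
    | cons b s ih =>
      simp only [Multiset.map_cons, Multiset.prod_cons, Multiset.card_cons, pow_succ, ← ih]
      ring
  have key : ∀ s : Multiset ℂ, (aeval M (s.map fun a => X - C a).prod).det =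
      (M.charpoly.roots.map fun b => ((s.map fun a => X - C a).prod).eval b).prod := by
    intro s
    induction s using Multiset.induction_on with
    | empty => simp
    | cons a s ih =>
      simp only [Multiset.map_cons, Multiset.prod_cons, map_mul, det_mul, ih, eval_mul,
        Multiset.prod_map_mul]
      simp [lin]
  have hp := (IsAlgClosed.splits p).eq_prod_roots
  have hc : M.charpoly.roots.card = Fintype.card n := by
    rw [← (IsAlgClosed.splits M.charpoly).natDegree_eq_card_roots, charpoly_natDegree_eq_dim]
  rw [hp, map_mul, det_mul, key]
  simp only [eval_mul, Multiset.prod_map_mul, eval_C, aeval_C, Multiset.map_const',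
    Multiset.prod_replicate, hc]
  congr 1
  rw [algebraMap_eq_diagonal, det_diagonal]
  simp

theorem trace_pow_eq_sum_roots (M : Matrix n n ℂ) (k : ℕ) :
    (M ^ k).trace = (M.charpoly.roots.map fun a => a ^ k).sum := by
  have h : (M ^ k).charpoly = ((M.charpoly.roots.map fun a => a ^ k).map fun a => X - C a).prod := by
    refine Polynomial.funext fun x => ?_
    have := det_aeval_eq_prod_roots M (C x - X ^ k)
    rw [eval_charpoly]
    simp only [map_sub, aeval_C, map_pow, aeval_X, eval_sub, eval_C, eval_pow, eval_X] at this
    rw [eval_multiset_prod, Multiset.map_map, Multiset.map_map]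
    simpa [algebraMap_eq_diagonal, Pi.algebraMap_def] using this
  rw [trace_eq_sum_roots_charpoly, h, roots_multiset_prod_X_sub_C]

theorem det_one_sub_smul_eq_prod_roots (M : Matrix n n ℂ) (s : ℂ) :
    (1 - s • M).det = (M.charpoly.roots.map fun a => 1 - s * a).prod := by
  have := det_aeval_eq_prod_roots M (1 - C s * X)
  simpa [Algebra.smul_def] using this

/-- `det (1 - sM) = exp (-∑ₖ tr (Mᵏ) sᵏ / k)` for small `s`. -/
theorem exists_hasSum_trace_pow (M : Matrix n n ℂ) :
    ∃ r > 0, ∀ s : ℂ, ‖s‖ < r → ∃ a : ℂ,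
      HasSum (fun k : ℕ => s ^ (k + 1) * (M ^ (k + 1)).trace / (k + 1)) (-a) ∧
      (1 - s • M).det = Complex.exp a := by
  simp only [trace_pow_eq_sum_roots, det_one_sub_smul_eq_prod_roots]
  induction M.charpoly.roots using Multiset.induction_on with
  | empty => exact ⟨1, one_pos, fun s _ => ⟨0, by simp, by simp⟩⟩
  | cons b t ih =>
    obtain ⟨r, hr, h⟩ := ih
    -- This radius forces `‖s * b‖ < 1`, the disc of the logarithm series; the `+ 1` allows `b = 0`.
    refine ⟨min r (‖b‖ + 1)⁻¹, lt_min hr (by positivity), fun s hs => ?_⟩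
    obtain ⟨a, ha, ha'⟩ := h s (hs.trans_le (min_le_left _ _))
    have hsb : ‖s * b‖ < 1 := by
      have h1 := hs.trans_le (min_le_right _ _)
      have h0 : 0 < ‖b‖ + 1 := by positivity
      rw [norm_mul]
      calc ‖s‖ * ‖b‖ ≤ (‖b‖ + 1)⁻¹ * ‖b‖ := by gcongr
        _ < (‖b‖ + 1)⁻¹ * (‖b‖ + 1) := by gcongr; linarith
        _ = 1 := inv_mul_cancel₀ h0.ne'
    have h0 : 1 - s * b ≠ 0 := by
      intro h
      rw [← sub_eq_zero.mp h] at hsb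
      simp at hsb
    refine ⟨Complex.log (1 - s * b) + a, ?_, ?_⟩
    · rw [neg_add]
      refine ((Complex.hasSum_taylorSeries_neg_log' hsb).add ha).congr_fun ?_
      intro k
      simp only [Multiset.map_cons, Multiset.sum_cons]
      ring
    · simp only [Multiset.map_cons, Multiset.prod_cons, ha']
      rw [Complex.exp_add, Complex.exp_log h0]

end Matrix

/-! ### Block triangularization along a partition -/

namespace Matrix

/-- If the sums of each row of `M` over the cells of `c` depend only on the cell of the row, then
the characteristic polynomial of the quotient matrix `N` splits off. -/
theorem charpoly_eq_mul_of_cells {V ι R : Type*} [Fintype V] [DecidableEq V] [Fintype ι]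
    [DecidableEq ι] [CommRing R] (M : Matrix V V R) (c : V → ι) (w : ι → V)
    (hw : ∀ i, c (w i) = i) (N : Matrix ι ι R)
    (hN : ∀ u j, ∑ v with c v = j, M u v = N (c u) j) :
    M.charpoly = N.charpoly *
      (of fun u v : MultiDigraph.Remaining w => M u v - M (w (c u)) v).charpoly := by
  let e : ι ⊕ MultiDigraph.Remaining w ≃ V :=
    { toFun := Sum.elim w Subtype.val
      invFun := fun v => if h : ∀ i, v ≠ w i then Sum.inr ⟨v, h⟩ else Sum.inl (c v)
      left_inv := by
        rintro (i | ⟨v, hv⟩)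
        · have : ¬ ∀ j, w i ≠ w j := fun h => h i rfl
          simp [hw]
        · simp [hv]
      right_inv := by
        intro v
        by_cases h : ∀ i, v ≠ w i
        · simp [h]
        · obtain ⟨i, hi⟩ := not_forall_not.mp h
          subst hi
          have : ¬ ∀ j, w i ≠ w j := fun h => h i rfl
          simp only [dif_neg this, hw, Sum.elim_inl] }
  let P : Matrix (MultiDigraph.Remaining w) ι R := of fun v i => if c v = i then 1 else 0
  let A : Matrix ι ι R := of fun i j => M (w i) (w j)
  let B : Matrix ι (MultiDigraph.Remaining w) R := of fun i v => M (w i) v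
  let C : Matrix (MultiDigraph.Remaining w) ι R := of fun v i => M v (w i)
  let D : Matrix (MultiDigraph.Remaining w) (MultiDigraph.Remaining w) R := of fun u v => M u v
  let T : Matrix (MultiDigraph.Remaining w) (MultiDigraph.Remaining w) R :=
    of fun u v => M u v - M (w (c u)) v
  have hM : M.reindex e.symm e.symm = fromBlocks A B C D := by
    ext (i | i) (j | j) <;> rfl
  have cell (u : V) (j : ι) :
      M u (w j) + ∑ v : MultiDigraph.Remaining w, M u v * (if c v = j then 1 else 0) =
        N (c u) j := by
    rw [← hN, Finset.sum_filter, ← e.sum_comp, Fintype.sum_sum_type]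
    simp [e, hw]
  have hA : A + B * P = N := by
    ext i j
    simpa [mul_apply, A, B, P, hw] using cell (w i) j
  have hC : C + D * P = P * N := by
    ext u j
    simpa [mul_apply, C, D, P] using cell u j
  have hT : T = D - P * B := by
    ext u v
    simp [T, D, P, B, mul_apply]
  let Q : (Matrix (ι ⊕ MultiDigraph.Remaining w) (ι ⊕ MultiDigraph.Remaining w) R)ˣ :=
    ⟨fromBlocks 1 0 P 1, fromBlocks 1 0 (-P) 1, by simp [fromBlocks_multiply],
      by simp [fromBlocks_multiply]⟩
  have hQ : fromBlocks A B C D * Q.1 = Q.1 * fromBlocks N B 0 T := by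
    simp [Q, fromBlocks_multiply, hA, hC, hT]
  have := charpoly_units_conj' Q (fromBlocks A B C D)
  rw [← coe_units_inv, mul_assoc, hQ, Units.inv_mul_cancel_left, charpoly_fromBlocks_zero₂₁] at this
  rw [← charpoly_reindex e.symm M, hM, ← this]

end Matrix

/-! ### Equitable partitions, quotient and deletion graphs -/

namespace MultiDigraph

variable {V E ι : Type*} [DecidableEq V] [Fintype E] [DecidableEq ι]

theorem quotientGraph_adjMatrix_apply [Fintype ι] {X : MultiDigraph V E} {c : V → ι} (h : X.IsEquitable c)
    (i j : ι) : (quotientGraph h).adjMatrix ℂ i j = h.edgeCount i j := by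
  simp only [adjMatrix, Matrix.of_apply]
  congr 1
  rw [← Fintype.card_fin (h.edgeCount i j), ← Finset.card_univ,
    ← Finset.card_map ⟨fun k => (⟨i, j, k⟩ : Σ i : ι, Σ j : ι, Fin (h.edgeCount i j)), fun a b hab => by
      simpa using hab⟩]
  congr 1
  ext ⟨a, b, k⟩
  rw [Finset.mem_map, Finset.mem_filter]
  constructor
  · rintro ⟨_, rfl, rfl⟩; exact ⟨k, Finset.mem_univ _, rfl⟩
  · rintro ⟨k', _, hk⟩
    cases hk
    exact ⟨Finset.mem_univ _, rfl, rfl⟩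

variable [Fintype V]

theorem sum_adjMatrix_cell (X : MultiDigraph V E) (c : V → ι) (u : V) (j : ι) :
    ∑ v with c v = j, X.adjMatrix ℂ u v =
      (Finset.univ.filter fun e => X.origin e = u ∧ c (X.terminus e) = j).card := by
  simp only [adjMatrix, Matrix.of_apply, ← Nat.cast_sum]
  congr 1
  rw [Finset.card_eq_sum_card_fiberwise (f := X.terminus) (t := Finset.univ.filter fun v => c v = j)]
  · refine Finset.sum_congr rfl fun v hv => ?_
    congr 1
    ext e
    simp only [Finset.mem_filter, Finset.mem_univ, true_and] at hv ⊢
    constructor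
    · rintro ⟨h1, rfl⟩; exact ⟨⟨h1, hv⟩, rfl⟩
    · rintro ⟨⟨h1, _⟩, h2⟩; exact ⟨h1, h2⟩
  · intro e he
    simpa using (Finset.mem_filter.mp he).2.2

theorem sum_adjMatrix_row (X : MultiDigraph V E) (u : V) :
    ∑ v, X.adjMatrix ℂ u v = X.degree u := by
  have := X.sum_adjMatrix_cell (fun _ => ()) u ()
  simpa [degree] using this

variable [Fintype ι]

theorem IsEquitable.sum_cell {X : MultiDigraph V E} {c : V → ι} (h : X.IsEquitable c)
    (u : V) (j : ι) :
    ∑ v with c v = j, X.adjMatrix ℂ u v = (quotientGraph h).adjMatrix ℂ (c u) j := by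
  rw [sum_adjMatrix_cell, quotientGraph_adjMatrix_apply]
  exact_mod_cast (h (c u) j).choose_spec u rfl

/-- This makes the degree matrix an admissible `D`, with the out-degrees of the quotient as the `d
i`. -/
theorem IsEquitable.degree_eq {X : MultiDigraph V E} {c : V → ι} (h : X.IsEquitable c) (u : V) :
    (X.degree u : ℂ) = (quotientGraph h).degree (c u) := by
  rw [← sum_adjMatrix_row, ← sum_adjMatrix_row (quotientGraph h)]
  simp only [← h.sum_cell]
  rw [← Finset.sum_fiberwise Finset.univ c]

theorem deletionGraph_adjMatrix_apply (X : MultiDigraph V E) (c : V → ι) (w : ι → V)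
    (u v : Remaining w) :
    (X.deletionGraph c w).adjMatrix ℂ u v =
      X.adjMatrix ℂ u v - X.adjMatrix ℂ (w (c u)) v := by
  have h1 : (X.restrict fun v => ∀ i, v ≠ w i).adjMatrix ℤ u v = X.adjMatrix ℤ u v := by
    simp only [adjMatrix, Matrix.of_apply, restrict]
    congr 1
    rw [← Finset.card_map (Function.Embedding.subtype _)]
    congr 1
    ext e
    simp only [Finset.mem_map, Finset.mem_filter, Finset.mem_univ, true_and,
      Function.Embedding.subtype_apply, Subtype.exists, Subtype.ext_iff]
    constructor
    · rintro ⟨a, ha, hab, rfl⟩; exact hab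
    · rintro ⟨ha, hb⟩; exact ⟨e, ⟨ha ▸ u.2, hb ▸ v.2⟩, ⟨ha, hb⟩, rfl⟩
  have h2 : ∑ p : ι × ι, (X.bundle w (remainingCell c w p.1) (w p.1)
      (remainingCell c w p.2)).adj u v = X.adjMatrix ℤ (w (c u)) v := by
    -- The cells are disjoint, so only one bundle reaches the entry `(u, v)`.
    rw [Finset.sum_eq_single (c u, c v)]
    · simp [bundle, remainingCell]
    · rintro ⟨i, j⟩ _ hij
      simp only [bundle, remainingCell, Matrix.of_apply, Finset.mem_filter, Finset.mem_univ,
        true_and, ite_eq_right_iff]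
      rintro ⟨rfl, rfl⟩
      exact absurd rfl hij
    · simp
  simp only [SignedDigraph.adjMatrix, deletionGraph, SignedDigraph.sub, SignedDigraph.sum,
    toSigned, Matrix.map_apply, Matrix.sub_apply, Matrix.sum_apply, h1, h2]
  simp [adjMatrix]

theorem IsEquitable.charpoly_eq {X : MultiDigraph V E} {c : V → ι} (h : X.IsEquitable c)
    {w : ι → V} (hw : ∀ i, c (w i) = i) (α : ℂ) {D : Matrix V V ℂ} {d : ι → ℂ} (hD : D.IsDiag)
    (hd : ∀ v, D v v = d (c v)) :
    (α • X.adjMatrix ℂ + D).charpoly =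
      (α • (quotientGraph h).adjMatrix ℂ + Matrix.diagonal d).charpoly *
      (α • (X.deletionGraph c w).adjMatrix ℂ + D.restrictRemaining w).charpoly := by
  rw [Matrix.charpoly_eq_mul_of_cells _ c w hw (α • (quotientGraph h).adjMatrix ℂ
    + Matrix.diagonal d)]
  · congr 2
    ext u v
    -- Subtracting the row of the deleted vertex leaves `D` unchanged, since `v` is not that vertex.
    have : D (w (c u)) v = 0 := hD fun hh => v.2 _ hh.symm
    simp only [Matrix.of_apply, Matrix.add_apply, Matrix.smul_apply, smul_eq_mul,
      deletionGraph_adjMatrix_apply, Matrix.restrictRemaining, Matrix.submatrix_apply, this]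
    ring
  · intro u j
    simp only [Matrix.add_apply, Matrix.smul_apply, Finset.sum_add_distrib, ← Finset.smul_sum,
      h.sum_cell]
    congr 1
    rw [Finset.sum_filter, Finset.sum_eq_single u]
    · simp [Matrix.diagonal_apply, hd]
    · intro v _ hv
      simp [hD hv.symm]
    · simp

theorem IsEquitable.det_eq {X : MultiDigraph V E} {c : V → ι} (h : X.IsEquitable c)
    {w : ι → V} (hw : ∀ i, c (w i) = i) (α : ℂ) {D : Matrix V V ℂ} {d : ι → ℂ} (hD : D.IsDiag)
    (hd : ∀ v, D v v = d (c v)) :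
    (α • X.adjMatrix ℂ + D).det =
      (α • (quotientGraph h).adjMatrix ℂ + Matrix.diagonal d).det *
      (α • (X.deletionGraph c w).adjMatrix ℂ + D.restrictRemaining w).det := by
  -- Negating both `α` and `D` makes the characteristic polynomials at `0` the determinants
  -- themselves, without signs.
  have := congrArg (Polynomial.eval 0) (h.charpoly_eq hw (-α) (D := -D) (d := -d) hD.neg
    (by simpa using hd))
  simp only [Polynomial.eval_mul, Matrix.eval_charpoly, map_zero, zero_sub] at this
  convert this using 3
  · simp [neg_add_rev, add_comm]
  · ext i j
    simp [Matrix.diagonal_apply]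
    split_ifs <;> simp [add_comm]
  · ext i j
    simp [Matrix.restrictRemaining, add_comm]

end MultiDigraph

/-! ### Bartholdi's determinant formula -/

namespace UndirectedMultigraph

variable {V E : Type*}

theorem terminus_inv (X : UndirectedMultigraph V E) (e : E) :
    X.terminus (X.inv e) = X.origin e := by
  rw [← X.origin_inv, X.inv_inv]

/-- Involutions without fixed points have an orientation: a set that contains exactly one of
`e` and `inv e`. -/
theorem exists_orientation [Finite E] (X : UndirectedMultigraph V E) (h : ∀ e, X.inv e ≠ e) :
    ∃ p : E → Prop, ∀ e, p (X.inv e) ↔ ¬ p e := by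
  obtain ⟨n, ⟨f⟩⟩ := Finite.exists_equiv_fin E
  refine ⟨fun e => f e < f (X.inv e), fun e => ?_⟩
  have : f e ≠ f (X.inv e) := fun hh => h e (f.injective hh).symm
  show f (X.inv e) < f (X.inv (X.inv e)) ↔ ¬ f e < f (X.inv e)
  rw [X.inv_inv, not_lt]
  exact ⟨le_of_lt, fun hh => lt_of_le_of_ne hh this.symm⟩

theorem numEdges_eq [Finite E] (X : UndirectedMultigraph V E) {p : E → Prop}
    (hp : ∀ e, p (X.inv e) ↔ ¬ p e) : X.numEdges = Nat.card {e // p e} := by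
  have : (Set.range fun e : E => s(e, X.inv e)) =
      Set.range fun e : {e // p e} => s(e.1, X.inv e.1) := by
    ext z
    constructor
    · rintro ⟨e, rfl⟩
      by_cases he : p e
      · exact ⟨⟨e, he⟩, rfl⟩
      · exact ⟨⟨X.inv e, (hp e).2 he⟩, by simp [X.inv_inv, Sym2.eq_swap]⟩
    · rintro ⟨e, rfl⟩
      exact ⟨e, rfl⟩
  rw [numEdges, this, ← Nat.card_coe_set_eq, Nat.card_range_of_injective]
  rintro ⟨e, he⟩ ⟨f, hf⟩ hef
  rw [Subtype.mk.injEq]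
  rcases Sym2.eq_iff.mp hef with h | h
  · exact h.1
  · refine absurd hf ?_
    have := (hp e).not.2 (not_not.2 he)
    rwa [h.2] at this

variable [Fintype E] [DecidableEq E]

/-- The matrix of the involution `e ↦ inv e`. -/
def invMatrix (X : UndirectedMultigraph V E) : Matrix E E ℂ :=
  Matrix.of fun e f => if f = X.inv e then 1 else 0

theorem invMatrix_mul_self (X : UndirectedMultigraph V E) : X.invMatrix * X.invMatrix = 1 := by
  ext e f
  simp only [invMatrix, Matrix.mul_apply, Matrix.of_apply, Matrix.one_apply]
  rw [Finset.sum_eq_single (X.inv e)]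
  · simp [X.inv_inv, eq_comm]
  · intro g _ hg
    simp [hg]
  · simp

/-- Ordering the edges as an orientation followed by its inverses turns the matrix into the blocks
`1, a, a, 1`, each of size `numEdges`. -/
theorem det_one_add_smul_invMatrix (X : UndirectedMultigraph V E) (h : ∀ e, X.inv e ≠ e) (a : ℂ) :
    (1 + a • X.invMatrix).det = (1 - a ^ 2) ^ X.numEdges := by
  classical
  obtain ⟨p, hp⟩ := X.exists_orientation h
  have hpp (e : {e // p e}) : ¬ p (X.inv e) := fun hh => (hp _).1 hh e.2
  have hpq (e : {e // p e}) (f : E) (hf : f = X.inv e) : ¬ p f := hf ▸ hpp e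
  let g : {e // p e} ⊕ {e // p e} ≃ E :=
    { toFun := Sum.elim Subtype.val fun e => X.inv e.1
      invFun := fun e => if he : p e then Sum.inl ⟨e, he⟩ else Sum.inr ⟨X.inv e, (hp e).2 he⟩
      left_inv := by
        rintro (e | e)
        · simp [e.2]
        · simp [hpp, X.inv_inv]
      right_inv := by
        intro e
        by_cases he : p e
        · simp [he]
        · simp [he, X.inv_inv] }
  have hinv : Function.Injective X.inv := (show Function.Involutive X.inv from X.inv_inv).injective
  have hg : (1 + a • X.invMatrix).reindex g.symm g.symm =
      Matrix.fromBlocks 1 (a • 1) (a • 1) 1 := by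
    ext (e | e) (f | f)
    · have : f.1 ≠ X.inv e := fun hh => hpq e f hh f.2
      simp [g, invMatrix, Matrix.one_apply, this, Subtype.ext_iff]
    · have : e.1 ≠ X.inv f := fun hh => hpq f e hh e.2
      simp [g, invMatrix, Matrix.one_apply, this, Subtype.ext_iff, hinv.eq_iff, eq_comm]
    · have : f.1 ≠ X.inv e := fun hh => hpq e f hh f.2
      simp [g, invMatrix, Matrix.one_apply, this.symm, Subtype.ext_iff, X.inv_inv, eq_comm]
    · have : X.inv f ≠ e := fun hh => hpq f e hh.symm e.2
      simp [g, invMatrix, Matrix.one_apply, this, Subtype.ext_iff, hinv.eq_iff, X.inv_inv]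
  rw [← Matrix.det_reindex_self g.symm, hg, Matrix.det_fromBlocks_one₁₁, X.numEdges_eq hp]
  have : (1 : Matrix {e // p e} {e // p e} ℂ) - a • 1 * a • 1 = (1 - a ^ 2) • 1 := by
    rw [smul_mul_smul_comm, mul_one, sub_smul, one_smul, pow_two]
  rw [this, Matrix.det_smul, Matrix.det_one, mul_one, Nat.card_eq_fintype_card]

variable [Fintype V] [DecidableEq V]

/-- The edge matrix of the Ihara-Bartholdi zeta function. -/
def edgeMatrix (X : UndirectedMultigraph V E) (u t : ℂ) : Matrix E E ℂ :=
  Matrix.of fun e f => if X.terminus e = X.origin f then (if f = X.inv e then u * t else t) else 0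

/-- With `J` the involution matrix, the edge adjacency factors through the vertices as `T * S`,
where `S * T` is the adjacency and `S * J * T` the degree matrix. The factor `1 + a • J`, with
inverse `(1 - a ^ 2)⁻¹ • (1 - a • J)`, contributes the exponent `numEdges`; after Sylvester's
identity, clearing denominators on the vertex side contributes `-card V`. -/
theorem det_one_add_smul_invMatrix_sub (X : UndirectedMultigraph V E) (h : ∀ e, X.inv e ≠ e) (a t : ℂ)
    (ha : 1 - a ^ 2 ≠ 0 ∨ Fintype.card V ≤ X.numEdges) :
    (1 + a • X.invMatrix - t • Matrix.of fun e f : E =>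
        if X.terminus e = X.origin f then 1 else 0).det =
      (1 - a ^ 2) ^ ((X.numEdges : ℤ) - (Fintype.card V : ℤ)) *
        (-t • X.adjMatrix ℂ + ((1 - a ^ 2) • (1 : Matrix V V ℂ) + (t * a) • X.degMatrix)).det := by
  let T : Matrix E V ℂ := Matrix.of fun e v => if X.terminus e = v then 1 else 0
  let S : Matrix V E ℂ := Matrix.of fun v e => if X.origin e = v then 1 else 0
  have hTS : (Matrix.of fun e f : E => if X.terminus e = X.origin f then (1 : ℂ) else 0) = T * S := by
    ext e f
    simp [T, S, Matrix.mul_apply, eq_comm]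
  have hST : S * T = X.adjMatrix ℂ := by
    ext v v'
    simp [T, S, Matrix.mul_apply, MultiDigraph.adjMatrix, Finset.sum_boole, ← ite_and, and_comm]
  have hSJT : S * X.invMatrix * T = X.degMatrix := by
    have : X.invMatrix * T = Matrix.of fun e v => if X.origin e = v then 1 else 0 := by
      ext e v
      simp only [invMatrix, T, Matrix.mul_apply, Matrix.of_apply]
      rw [Finset.sum_eq_single (X.inv e)]
      · simp [X.terminus_inv]
      · intro g _ hg
        simp [hg]
      · simp
    rw [Matrix.mul_assoc, this]
    ext v v'
    simp only [S, Matrix.mul_apply, MultiDigraph.degMatrix, MultiDigraph.degree, Matrix.of_apply,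
      Matrix.diagonal_apply]
    by_cases hv : v = v'
    · subst hv
      simp [Finset.sum_boole, ← ite_and]
    · rw [if_neg hv]
      refine Finset.sum_eq_zero fun e _ => ?_
      by_cases he : X.origin e = v
      · simp [he, hv]
      · simp [he]
  rw [hTS]
  have main : ∀ a : ℂ, 1 - a ^ 2 ≠ 0 → (1 + a • X.invMatrix - t • (T * S)).det =
      (1 - a ^ 2) ^ ((X.numEdges : ℤ) - (Fintype.card V : ℤ)) *
        (-t • X.adjMatrix ℂ + ((1 - a ^ 2) • (1 : Matrix V V ℂ) + (t * a) • X.degMatrix)).det := by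
    intro a ha
    have hinv : (1 + a • X.invMatrix) * (1 - a • X.invMatrix) = (1 - a ^ 2) • 1 := by
      have := X.invMatrix_mul_self
      simp only [mul_sub, add_mul, smul_mul_smul_comm, this, one_mul, mul_one]
      module
    have e1 : 1 + a • X.invMatrix - t • (T * S) = (1 + a • X.invMatrix) *
        (1 - ((1 - a ^ 2)⁻¹ • t • (1 - a • X.invMatrix) * T) * S) := by
      rw [mul_sub, mul_one]
      congr 1
      rw [← Matrix.mul_assoc, ← Matrix.mul_assoc, Matrix.mul_smul, Matrix.mul_smul, hinv,
        smul_comm t, smul_smul, inv_mul_cancel₀ ha, one_smul, Matrix.smul_mul, Matrix.one_mul,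
        Matrix.smul_mul]
    have e2 : (-t • X.adjMatrix ℂ + ((1 - a ^ 2) • (1 : Matrix V V ℂ) + (t * a) • X.degMatrix)) =
        (1 - a ^ 2) • (1 - S * ((1 - a ^ 2)⁻¹ • t • (1 - a • X.invMatrix) * T)) := by
      have : S * ((1 - a ^ 2)⁻¹ • t • (1 - a • X.invMatrix) * T) =
          (1 - a ^ 2)⁻¹ • (t • X.adjMatrix ℂ - (t * a) • X.degMatrix) := by
        rw [← hST, ← hSJT]
        simp only [Matrix.smul_mul, Matrix.mul_smul, Matrix.mul_sub, Matrix.sub_mul,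
          Matrix.one_mul, Matrix.mul_assoc]
        module
      rw [this, smul_sub, smul_smul, mul_inv_cancel₀ ha]
      module
    rw [e1, Matrix.det_mul, X.det_one_add_smul_invMatrix h, Matrix.det_one_sub_mul_comm, e2,
      Matrix.det_smul, ← mul_assoc, ← zpow_natCast (1 - a ^ 2) (Fintype.card V), ← zpow_add₀ ha,
      sub_add_cancel, zpow_natCast]
  rcases ha with ha | ha
  · exact main a ha
  · rw [← Nat.cast_sub ha]
    simp only [← Nat.cast_sub ha, zpow_natCast] at main ⊢
    -- For a nonnegative exponent both sides are continuous in `a`, so the excluded values `a = ±1`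
    -- follow by density.
    refine congrFun (Continuous.ext_on (s := {a : ℂ | 1 - a ^ 2 ≠ 0}) ?_ ?_ ?_ main) a
    · have : {a : ℂ | 1 - a ^ 2 ≠ 0} = ({1, -1} : Set ℂ)ᶜ := by
        ext z
        simp only [Set.mem_ofPred_eq, Set.mem_compl_iff, Set.mem_insert_iff, Set.mem_singleton_iff]
        rw [sub_ne_zero, ne_comm, ne_eq, ← one_pow 2, sq_eq_sq_iff_eq_or_eq_neg, one_pow]
      rw [this]
      exact (Set.toFinite _).countable.dense_compl ℂ
    · exact Continuous.matrix_det (by fun_prop)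
    · exact Continuous.mul (by fun_prop) (Continuous.matrix_det (by fun_prop))

/-- Bartholdi's determinant formula. -/
theorem det_one_sub_edgeMatrix (X : UndirectedMultigraph V E) (h : ∀ e, X.inv e ≠ e) (u t : ℂ)
    (ha : 1 - (1 - u) ^ 2 * t ^ 2 ≠ 0 ∨ Fintype.card V ≤ X.numEdges) :
    (1 - X.edgeMatrix u t).det =
      (1 - (1 - u) ^ 2 * t ^ 2) ^ ((X.numEdges : ℤ) - (Fintype.card V : ℤ)) *
        (-t • X.adjMatrix ℂ + X.zetaDegMatrix u t).det := by
  -- The choice `a = (1 - u) * t` corrects the weight of a backtracking pair from `t` to `t - a = u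
  -- * t`.
  have := X.det_one_add_smul_invMatrix_sub h ((1 - u) * t) t (by rwa [mul_pow])
  rw [mul_pow, show t * ((1 - u) * t) = (1 - u) * t ^ 2 by ring] at this
  rw [MultiDigraph.zetaDegMatrix, ← this]
  congr 1
  rw [add_sub_assoc, sub_eq_add_neg]
  congr 1
  ext e f
  simp only [edgeMatrix, invMatrix, Matrix.neg_apply, Matrix.of_apply, Matrix.sub_apply,
    Matrix.smul_apply, smul_eq_mul]
  by_cases hf : f = X.inv e
  · subst hf
    simp only [X.origin_inv, if_true]
    ring
  · simp [hf]

end UndirectedMultigraph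

/-! ### Primitive words and their periods -/

namespace List

variable {α : Type*}

/-- The infinite periodic word `B B B ...`. -/
def periodicWord (B : List α) (i : ℕ) : Option α := B[i % B.length]?

/-- The shift of infinite words. -/
def shiftWord {β : Type*} (x : ℕ → β) (i : ℕ) : β := x (i + 1)

/-- A word is primitive if it is not a power `B ^ k` with `k ≥ 2`. -/
def IsPrimitive (B : List α) : Prop :=
  ∀ (A : List α) (k : ℕ), 2 ≤ k → B ≠ (replicate k A).flatten

theorem iterate_shiftWord {β : Type*} (x : ℕ → β) (n : ℕ) :
    shiftWord^[n] x = fun i => x (i + n) := by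
  induction n with
  | zero => rfl
  | succ n ih =>
    rw [Function.iterate_succ_apply', ih]
    funext i
    simp only [shiftWord]
    congr 1
    ring

theorem isPeriodicPt_periodicWord (B : List α) :
    Function.IsPeriodicPt shiftWord B.length B.periodicWord := by
  rw [Function.IsPeriodicPt, Function.IsFixedPt, iterate_shiftWord]
  funext i
  simp [periodicWord]

theorem periodicWord_eq_mod {B : List α} {g : ℕ}
    (h : Function.IsPeriodicPt shiftWord g B.periodicWord) (i : ℕ) :
    B.periodicWord i = B.periodicWord (i % g) := by
  have := (h.mul_const (i / g)).eq
  rw [iterate_shiftWord] at this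
  have := congrFun this (i % g)
  simp only [Nat.mod_add_div] at this
  exact this

theorem length_flatten_replicate (k : ℕ) (B : List α) :
    (replicate k B).flatten.length = k * B.length := by
  simp

theorem getElem?_flatten_replicate (B : List α) (k i : ℕ) (h : i < k * B.length) :
    (replicate k B).flatten[i]? = B[i % B.length]? := by
  induction k generalizing i with
  | zero => simp at h
  | succ k ih =>
    rw [replicate_succ, flatten_cons, getElem?_append]
    split_ifs with hi
    · rw [Nat.mod_eq_of_lt hi]
    · rw [not_lt] at hi
      rw [ih _ (by rw [Nat.succ_mul] at h; omega), ← Nat.mod_eq_sub_mod hi]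

theorem periodicWord_flatten_replicate (B : List α) (k : ℕ) :
    (replicate (k + 1) B).flatten.periodicWord = B.periodicWord := by
  funext i
  rcases eq_or_ne B [] with rfl | hB
  · simp [periodicWord]
  · have : 0 < B.length := length_pos_of_ne_nil hB
    rw [periodicWord, getElem?_flatten_replicate, periodicWord, length_flatten_replicate,
      Nat.mod_mul_left_mod]
    rw [length_flatten_replicate]
    exact Nat.mod_lt _ (by positivity)

theorem eq_flatten_replicate_take {B : List α} {g : ℕ} (hg : g ∣ B.length)
    (h : Function.IsPeriodicPt shiftWord g B.periodicWord) :
    B = (replicate (B.length / g) (B.take g)).flatten := by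
  rcases eq_or_ne B [] with rfl | hB
  · simp
  have hpos : 0 < B.length := length_pos_of_ne_nil hB
  have hg0 : 0 < g := Nat.pos_of_dvd_of_pos hg hpos
  have hle : g ≤ B.length := Nat.le_of_dvd hpos hg
  have hlen : (B.take g).length = g := by simpa using hle
  refine ext_getElem? fun i => ?_
  rcases lt_or_ge i B.length with hi | hi
  · rw [getElem?_flatten_replicate _ _ _ (by rwa [hlen, Nat.div_mul_cancel hg]), hlen,
      getElem?_take_of_lt (Nat.mod_lt _ hg0)]
    have h1 := periodicWord_eq_mod h i
    rwa [periodicWord, periodicWord, Nat.mod_eq_of_lt hi,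
      Nat.mod_eq_of_lt ((Nat.mod_lt i hg0).trans_le hle)] at h1
  · rw [getElem?_eq_none hi, getElem?_eq_none]
    rwa [length_flatten_replicate, hlen, Nat.div_mul_cancel hg]

/-- Periods are closed under gcd. If the gcd of `m` and the length were a proper divisor of the
length, `B` would be a power of its prefix of that length. -/
theorem IsPrimitive.length_dvd {B : List α} (hB : B.IsPrimitive) (h0 : B ≠ []) {m : ℕ}
    (h : Function.IsPeriodicPt shiftWord m B.periodicWord) : B.length ∣ m := by
  have hpos : 0 < B.length := length_pos_of_ne_nil h0
  have hg := B.isPeriodicPt_periodicWord.gcd h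
  have hd : B.length.gcd m ∣ B.length := Nat.gcd_dvd_left _ _
  have hk : B.length / B.length.gcd m < 2 := by
    by_contra! hk
    exact hB _ _ hk (eq_flatten_replicate_take hd hg)
  obtain ⟨q, hq⟩ := hd
  have hg0 : 0 < B.length.gcd m := Nat.gcd_pos_of_pos_left _ hpos
  have hq1 : q = 1 := by
    have h1 : B.length / B.length.gcd m = q := Nat.div_eq_of_eq_mul_right hg0 hq
    rw [h1] at hk
    have : q ≠ 0 := by
      rintro rfl
      omega
    omega
  rw [hq1, mul_one] at hq
  rw [hq]
  exact Nat.gcd_dvd_right _ _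

theorem IsPrimitive.eq_of_periodicWord_eq {A B : List α} (hA : A.IsPrimitive)
    (hB : B.IsPrimitive) (hA0 : A ≠ []) (hB0 : B ≠ []) (h : A.periodicWord = B.periodicWord) :
    A = B := by
  have hl : A.length = B.length := Nat.dvd_antisymm
    (hA.length_dvd hA0 (h ▸ B.isPeriodicPt_periodicWord))
    (hB.length_dvd hB0 (h ▸ A.isPeriodicPt_periodicWord))
  refine ext_getElem? fun i => ?_
  rcases lt_or_ge i A.length with hi | hi
  · have := congrFun h i
    rwa [periodicWord, periodicWord, Nat.mod_eq_of_lt hi, Nat.mod_eq_of_lt (hl ▸ hi)] at this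
  · rw [getElem?_eq_none hi, getElem?_eq_none (hl ▸ hi)]

theorem periodicWord_rotate (B : List α) (n : ℕ) :
    (B.rotate n).periodicWord = shiftWord^[n] B.periodicWord := by
  rw [iterate_shiftWord]
  funext i
  rcases eq_or_ne B [] with rfl | hB
  · simp [periodicWord]
  · have hpos : 0 < B.length := length_pos_of_ne_nil hB
    rw [periodicWord, length_rotate, getElem?_rotate (Nat.mod_lt _ hpos), periodicWord,
      Nat.mod_add_mod]

theorem IsPrimitive.rotate_inj {B : List α} (hB : B.IsPrimitive) {i j : ℕ} (hi : i < B.length)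
    (hj : j < B.length) (h : B.rotate i = B.rotate j) : i = j := by
  wlog hij : i ≤ j generalizing i j
  · exact (this hj hi h.symm (le_of_not_ge hij)).symm
  have h0 : B ≠ [] := by
    rintro rfl
    simp at hi
  have h1 := congrArg periodicWord h
  rw [periodicWord_rotate, periodicWord_rotate] at h1
  -- Shifting on by `B.length - i` completes a full turn on the left, so `j - i` becomes a period.
  have h2 := congrArg shiftWord^[B.length - i] h1
  rw [← Function.iterate_add_apply, ← Function.iterate_add_apply, Nat.sub_add_cancel hi.le,
    show B.length - i + j = j - i + B.length by omega, Function.iterate_add_apply,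
    B.isPeriodicPt_periodicWord.eq] at h2
  have h3 := Nat.eq_zero_of_dvd_of_lt (hB.length_dvd h0 h2.symm) (by omega)
  omega

theorem flatten_replicate_flatten_replicate (A : List α) (k l : ℕ) :
    (replicate k (replicate l A).flatten).flatten = (replicate (k * l) A).flatten := by
  induction k with
  | zero => simp
  | succ k ih =>
    rw [replicate_succ, flatten_cons, ih, Nat.succ_mul, add_comm, replicate_add, flatten_append]

theorem exists_isPrimitive_flatten_replicate (C : List α) (hC : C ≠ []) :
    ∃ (B : List α) (k : ℕ), B ≠ [] ∧ B.IsPrimitive ∧ C = (replicate (k + 1) B).flatten := by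
  induction hn : C.length using Nat.strong_induction_on generalizing C with
  | _ n ih =>
    by_cases hp : C.IsPrimitive
    · exact ⟨C, 0, hC, hp, by simp⟩
    · simp only [IsPrimitive] at hp
      push Not at hp
      obtain ⟨A, k, hk, hA⟩ := hp
      have hA0 : A ≠ [] := by
        rintro rfl
        exact hC (by simpa using hA)
      have hpos := length_pos_of_ne_nil hA0
      have hlen : C.length = k * A.length := by rw [hA, length_flatten_replicate]
      obtain ⟨B, l, hB0, hB, hAB⟩ := ih A.length (by nlinarith) A hA0 rfl
      -- Exponents multiply; the `- 1` offsets the convention that the exponent is `k + 1`.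
      refine ⟨B, k * (l + 1) - 1, hB0, hB, ?_⟩
      rw [Nat.sub_add_cancel (by nlinarith), ← flatten_replicate_flatten_replicate, ← hAB, hA]

theorem rotate_one_flatten_replicate (B : List α) (k : ℕ) :
    (replicate k B).flatten.rotate 1 = (replicate k (B.rotate 1)).flatten := by
  cases B with
  | nil => simp
  | cons a l =>
    cases k with
    | zero => simp
    | succ k =>
      rw [replicate_succ, flatten_cons, cons_append, rotate_cons_succ, rotate_zero,
        rotate_cons_succ, rotate_zero]
      induction k with
      | zero => simp
      | succ k ih =>
        rw [replicate_succ (n := k + 1), flatten_cons, ← ih]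
        simp [replicate_succ]

theorem rotate_flatten_replicate (B : List α) (k n : ℕ) :
    (replicate k B).flatten.rotate n = (replicate k (B.rotate n)).flatten := by
  induction n with
  | zero => simp
  | succ n ih => rw [← rotate_rotate, ih, rotate_one_flatten_replicate, rotate_rotate]

theorem IsPrimitive.of_isRotated {B C : List α} (hB : B.IsPrimitive) (h : B ~r C) :
    C.IsPrimitive := by
  obtain ⟨n, rfl⟩ := h.symm
  rintro A k hk rfl
  exact hB _ _ hk (rotate_flatten_replicate A k n)

theorem zip_flatten_replicate {β : Type*} (A : List α) (B : List β) (h : A.length = B.length)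
    (k : ℕ) : (replicate k A).flatten.zip (replicate k B).flatten =
      (replicate k (A.zip B)).flatten := by
  induction k with
  | zero => simp
  | succ k ih => rw [replicate_succ, replicate_succ, replicate_succ, flatten_cons, flatten_cons,
      flatten_cons, zip_append h, ih]

end List

/-! ### Closed paths, their weights and prime cycles -/

namespace UndirectedMultigraph

variable {V E : Type*}

theorem cyclicPairs_flatten_replicate (B : List E) (k : ℕ) :
    cyclicPairs (List.replicate k B).flatten = (List.replicate k (cyclicPairs B)).flatten := by
  rw [cyclicPairs, List.rotate_one_flatten_replicate, List.zip_flatten_replicate _ _ (by simp),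
    cyclicPairs]

theorem cyclicPairs_rotate (C : List E) (n : ℕ) :
    cyclicPairs (C.rotate n) = (cyclicPairs C).rotate n := by
  unfold cyclicPairs
  rw [List.rotate_rotate, Nat.add_comm, ← List.rotate_rotate]
  exact (List.zipWith_rotate_distrib Prod.mk _ _ _ (by simp)).symm

theorem IsClosedPath.of_isRotated {X : UndirectedMultigraph V E} {B C : List E}
    (hB : X.IsClosedPath B) (h : B ~r C) : X.IsClosedPath C := by
  obtain ⟨n, rfl⟩ := h
  refine ⟨fun h0 => hB.1 (List.rotate_eq_nil_iff.mp h0), fun p hp => hB.2 p ?_⟩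
  rwa [cyclicPairs_rotate, List.mem_rotate] at hp

theorem isClosedPath_flatten_replicate {X : UndirectedMultigraph V E} {B : List E} {k : ℕ} :
    X.IsClosedPath (List.replicate (k + 1) B).flatten ↔ X.IsClosedPath B := by
  simp only [IsClosedPath, cyclicPairs_flatten_replicate]
  simp

/-- The product of the entries of `M` at the cyclically consecutive entries of `C`. -/
def cycleWeight (M : Matrix E E ℂ) (C : List E) : ℂ :=
  ((cyclicPairs C).map fun p => M p.1 p.2).prod

theorem cycleWeight_flatten_replicate (M : Matrix E E ℂ) (B : List E) (k : ℕ) :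
    cycleWeight M (List.replicate k B).flatten = cycleWeight M B ^ k := by
  simp [cycleWeight, cyclicPairs_flatten_replicate, List.map_flatten, List.prod_flatten]

theorem length_cyclicPairs (C : List E) : (cyclicPairs C).length = C.length := by
  simp [cyclicPairs]

theorem cycleWeight_smul (M : Matrix E E ℂ) (s : ℂ) (C : List E) :
    cycleWeight (s • M) C = s ^ C.length * cycleWeight M C := by
  simp [cycleWeight, List.prod_map_mul, length_cyclicPairs]

theorem norm_cycleWeight_le {M : Matrix E E ℂ} {K : ℝ} (hM : ∀ e f, ‖M e f‖ ≤ K) (C : List E) :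
    ‖cycleWeight M C‖ ≤ K ^ C.length := by
  rw [cycleWeight, ← length_cyclicPairs]
  induction cyclicPairs C with
  | nil => simp
  | cons p l ih =>
    rw [List.map_cons, List.prod_cons, norm_mul, List.length_cons, pow_succ, mul_comm]
    exact mul_le_mul ih (hM _ _) (norm_nonneg _) ((norm_nonneg _).trans ih)

section EdgeMatrix

variable [DecidableEq V] [DecidableEq E]

theorem cycleWeight_edgeMatrix (X : UndirectedMultigraph V E) (u t : ℂ) {C : List E}
    (hC : X.IsClosedPath C) :
    cycleWeight (X.edgeMatrix u t) C = u ^ X.cyclicBumpCount C * t ^ C.length := by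
  have h := hC.2
  clear hC
  rw [cycleWeight, cyclicBumpCount, ← length_cyclicPairs]
  generalize cyclicPairs C = l at h
  induction l with
  | nil => simp
  | cons p l ih =>
    rw [List.map_cons, List.prod_cons, ih fun q hq => h q (List.mem_cons_of_mem _ hq),
      List.countP_cons, List.length_cons]
    simp only [edgeMatrix, Matrix.of_apply, h p List.mem_cons_self, if_true, decide_eq_true_eq]
    split_ifs <;> ring

/-- Lets sums over closed paths be taken over all nonempty lists of edges. -/
theorem cycleWeight_edgeMatrix_of_not_isClosedPath (X : UndirectedMultigraph V E) (u t : ℂ)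
    {C : List E} (h0 : C ≠ []) (hC : ¬ X.IsClosedPath C) :
    cycleWeight (X.edgeMatrix u t) C = 0 := by
  simp only [IsClosedPath, not_and, not_forall] at hC
  obtain ⟨p, hp, hne⟩ := hC h0
  exact List.prod_eq_zero (List.mem_map.mpr ⟨p, hp, by simp [edgeMatrix, hne]⟩)

end EdgeMatrix

namespace PrimeCycle

variable {X : UndirectedMultigraph V E}

/-- The closed paths in a prime cycle. -/
abbrev Rep (z : X.PrimeCycle) : Type _ := {B : List E // (B : Cycle E) = z.1}

theorem Rep.isClosedPath {z : X.PrimeCycle} (B : z.Rep) : X.IsClosedPath B.1 := (z.2 _ B.2).1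

theorem Rep.isPrimitive {z : X.PrimeCycle} (B : z.Rep) : B.1.IsPrimitive := (z.2 _ B.2).2

theorem Rep.length_eq {z : X.PrimeCycle} (B : z.Rep) : B.1.length = z.length :=
  (Cycle.length_coe B.1).symm.trans (congrArg Cycle.length B.2)

theorem Rep.cyclicBumpCount_eq [DecidableEq E] {z : X.PrimeCycle} (B : z.Rep) :
    X.cyclicBumpCount B.1 = z.cbc :=
  congrArg (Quotient.lift (s := List.IsRotated.setoid E) X.cyclicBumpCount
    fun _ _ h => X.cyclicBumpCount_eq_of_isRotated h) B.2

instance (z : X.PrimeCycle) : Nonempty z.Rep :=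
  let ⟨B, hB⟩ := Quotient.exists_rep z.1
  ⟨⟨B, hB⟩⟩

theorem length_pos (z : X.PrimeCycle) : 0 < z.length := by
  obtain ⟨B⟩ : Nonempty z.Rep := inferInstance
  rw [← B.length_eq]
  exact List.length_pos_of_ne_nil B.isClosedPath.1

/-- A prime cycle of length `k` consists of `k` closed paths. -/
theorem exists_equiv_rep (z : X.PrimeCycle) : Nonempty (Fin z.length ≃ z.Rep) := by
  obtain ⟨B⟩ : Nonempty z.Rep := inferInstance
  have hrot (i : ℕ) : ((B.1.rotate i : List E) : Cycle E) = z.1 :=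
    (Cycle.coe_eq_coe.mpr (List.IsRotated.symm ⟨i, rfl⟩)).trans B.2
  refine ⟨Equiv.ofBijective (fun i => ⟨B.1.rotate i, hrot i⟩) ⟨fun i j hij => ?_, fun C => ?_⟩⟩
  · exact Fin.ext (B.isPrimitive.rotate_inj (i.2.trans_eq B.length_eq.symm)
      (j.2.trans_eq B.length_eq.symm)
      (congrArg Subtype.val hij))
  · have : B.1 ~r C.1 := by rw [← Cycle.coe_eq_coe, B.2, C.2]
    obtain ⟨n, hn⟩ := this
    refine ⟨⟨n % z.length, Nat.mod_lt _ z.length_pos⟩, Subtype.ext ?_⟩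
    have h := List.rotate_mod B.1 n
    rw [B.length_eq] at h
    exact h.trans hn

/-- The powers of the closed paths in prime cycles. -/
def power (p : Σ z : X.PrimeCycle, z.Rep × ℕ) : List E :=
  (List.replicate (p.2.2 + 1) p.2.1.1).flatten

/-- A power has the same infinite periodic word as its base, which determines a primitive base; the
length then determines the exponent. -/
theorem power_injective : Function.Injective (power (X := X)) := by
  rintro ⟨z, B, k⟩ ⟨z', B', k'⟩ h
  simp only [power] at h
  have hB : B.1 = B'.1 := by
    refine B.isPrimitive.eq_of_periodicWord_eq B'.isPrimitive B.isClosedPath.1 B'.isClosedPath.1 ?_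
    rw [← List.periodicWord_flatten_replicate B.1 k, h, List.periodicWord_flatten_replicate]
  have hk := congrArg List.length h
  rw [List.length_flatten_replicate, List.length_flatten_replicate, hB] at hk
  have := Nat.eq_of_mul_eq_mul_right (List.length_pos_of_ne_nil B'.isClosedPath.1) hk
  obtain rfl : z = z' := Subtype.ext (by rw [← B.2, ← B'.2, hB])
  obtain rfl : B = B' := Subtype.ext hB
  obtain rfl : k = k' := by omega
  rfl

theorem mem_range_power {C : List E} (hC : X.IsClosedPath C) : C ∈ Set.range (power (X := X)) := by
  obtain ⟨B, k, hB0, hB, rfl⟩ := C.exists_isPrimitive_flatten_replicate hC.1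
  rw [isClosedPath_flatten_replicate] at hC
  refine ⟨⟨⟨B, fun A hA => ?_⟩, ⟨B, rfl⟩, k⟩, rfl⟩
  have : B ~r A := (Cycle.coe_eq_coe.mp hA).symm
  exact ⟨hC.of_isRotated this, hB.of_isRotated this⟩

end PrimeCycle

end UndirectedMultigraph

/-! ### Traces of powers as sums over cycles -/

namespace UndirectedMultigraph

variable {E : Type*}

/-- The product of the entries of `M` along the path that starts at `e`, passes through the
list and ends at `f`. -/
def pathWeight (M : Matrix E E ℂ) : E → List E → E → ℂ
  | e, [], f => M e f
  | e, a :: l, f => M e a * pathWeight M a l f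

theorem cycleWeight_cons (M : Matrix E E ℂ) (e : E) (l : List E) :
    cycleWeight M (e :: l) = pathWeight M e l e := by
  have key : ∀ (a : E) (l : List E) (f : E),
      (((a :: l).zip (l ++ [f])).map fun p => M p.1 p.2).prod = pathWeight M a l f := by
    intro a l f
    induction l generalizing a with
    | nil => simp [pathWeight]
    | cons b l ih => simp [pathWeight, ← ih]
  rw [cycleWeight, cyclicPairs, List.rotate_cons_succ, List.rotate_zero, key]

variable [Fintype E]

theorem sum_vector_succ {n : ℕ} (g : List.Vector E (n + 1) → ℂ) :
    ∑ v, g v = ∑ a, ∑ v : List.Vector E n, g (a ::ᵥ v) := by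
  rw [← Fintype.sum_prod_type']
  exact (Fintype.sum_equiv ⟨fun p : E × List.Vector E n => p.1 ::ᵥ p.2, fun v => (v.head, v.tail),
    fun p => by simp, fun v => by simp⟩ _ _ fun _ => rfl).symm

/-- The `card E ^ n` lists of length `n` have weight at most `K ^ n` each, which gives a geometric
majorant. -/
theorem summable_cycleWeight {M : Matrix E E ℂ} {K : ℝ} (hM : ∀ e f, ‖M e f‖ ≤ K) (hK0 : 0 ≤ K)
    (hK : Fintype.card E * K < 1) : Summable fun C : List E => ‖cycleWeight M C‖ := by
  have h : Summable fun C : List E => K ^ C.length := by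
    rw [← (Equiv.sigmaFiberEquiv (List.length (α := E))).summable_iff]
    have hf (n : ℕ) : HasSum (fun C : {C : List E // C.length = n} => K ^ C.1.length)
        ((Fintype.card E * K) ^ n) := by
      have := hasSum_fintype fun _ : List.Vector E n => K ^ n
      rw [Finset.sum_const, Finset.card_univ, card_vector, nsmul_eq_mul, Nat.cast_pow,
        ← mul_pow] at this
      exact this.congr_fun fun v => by rw [v.2]
    refine (summable_sigma_of_nonneg fun _ => pow_nonneg hK0 _).2 ⟨fun n => (hf n).summable, ?_⟩
    exact (summable_geometric_of_lt_one (by positivity) hK).congr fun n => (hf n).tsum_eq.symm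
  exact h.of_nonneg_of_le (fun _ => norm_nonneg _) (norm_cycleWeight_le hM)

variable [DecidableEq E]

theorem pow_succ_apply_eq_sum_pathWeight (M : Matrix E E ℂ) (n : ℕ) (e f : E) :
    (M ^ (n + 1)) e f = ∑ v : List.Vector E n, pathWeight M e v.1 f := by
  induction n generalizing e with
  | zero =>
    rw [Fintype.sum_subsingleton _ List.Vector.nil, zero_add, pow_one]
    rfl
  | succ n ih =>
    rw [pow_succ', Matrix.mul_apply, sum_vector_succ]
    refine Finset.sum_congr rfl fun a _ => ?_
    rw [ih, Finset.mul_sum]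
    rfl

theorem trace_pow_succ_eq_sum_cycleWeight (M : Matrix E E ℂ) (n : ℕ) :
    (M ^ (n + 1)).trace = ∑ v : List.Vector E (n + 1), cycleWeight M v.1 := by
  rw [sum_vector_succ, Matrix.trace]
  refine Finset.sum_congr rfl fun e _ => ?_
  rw [Matrix.diag_apply, pow_succ_apply_eq_sum_pathWeight]
  refine Finset.sum_congr rfl fun v _ => ?_
  exact (cycleWeight_cons M e v.1).symm

/-- `∑_C wt(C) / |C| = ∑ₙ tr(Mⁿ) / n`. -/
theorem hasSum_cycleWeight_div_length {M : Matrix E E ℂ}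
    (hs : Summable fun C : List E => ‖cycleWeight M C‖) {b : ℂ}
    (hb : HasSum (fun n : ℕ => (M ^ (n + 1)).trace / (n + 1)) b) :
    HasSum (fun C : List E => cycleWeight M C / C.length) b := by
  have hs' : Summable fun C : List E => cycleWeight M C / C.length := by
    refine Summable.of_norm_bounded hs fun C => ?_
    rw [norm_div]
    rcases Nat.eq_zero_or_pos C.length with h | h
    · simp [h]
    · refine div_le_self (norm_nonneg _) ?_
      rw [Complex.norm_natCast]
      exact_mod_cast h
  have h1 := hs'.hasSum
  rw [← (Equiv.sigmaFiberEquiv (List.length (α := E))).hasSum_iff] at h1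
  have h2 (n : ℕ) : HasSum (fun C : {C : List E // C.length = n} => cycleWeight M C.1 / C.1.length)
      (∑ v : List.Vector E n, cycleWeight M v.1 / n) := by
    have := hasSum_fintype fun v : List.Vector E n => cycleWeight M v.1 / n
    refine HasSum.congr_fun this fun v => ?_
    rw [v.2]
  have h3 := h1.sigma h2
  -- The term of length zero comes from the empty list and vanishes, as division by zero gives `0`.
  rw [← hasSum_nat_add_iff' 1] at h3
  have h4 := h3.unique (hb.congr_fun fun n => ?_)
  · simp at h4
    rw [← h4]
    exact hs'.hasSum
  · rw [trace_pow_succ_eq_sum_cycleWeight, Finset.sum_div]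
    push_cast
    rfl

end UndirectedMultigraph

/-- Used with `β` the set of closed paths in one prime cycle: the division by the length of the
cycle cancels the number of its starting points. -/
theorem HasSum.const_div_card {β : Type*} [Finite β] [Nonempty β] {f : ℕ → ℂ} {c : ℂ}
    (hf : HasSum f c) (hs : Summable fun p : β × ℕ => f p.2 / Nat.card β) :
    HasSum (fun p : β × ℕ => f p.2 / Nat.card β) c := by
  have := Fintype.ofFinite β
  have h1 := hs.hasSum.prod_fiberwise fun _ => hf.div_const (Nat.card β : ℂ)
  have h2 := h1.unique (hasSum_fintype _)
  have h3 : (Fintype.card β : ℂ) ≠ 0 := Nat.cast_ne_zero.mpr Fintype.card_ne_zero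
  rw [Finset.sum_const, Finset.card_univ, nsmul_eq_mul, Nat.card_eq_fintype_card,
    mul_div_cancel₀ _ h3] at h2
  simpa only [Nat.card_eq_fintype_card, h2] using hs.hasSum

/-! ### The Euler product as a determinant -/

namespace UndirectedMultigraph

variable {V E : Type*} [DecidableEq V] [DecidableEq E]

theorem norm_edgeMatrix_le (X : UndirectedMultigraph V E) (u t : ℂ) (e f : E) :
    ‖X.edgeMatrix u t e f‖ ≤ (1 + ‖u‖) * ‖t‖ := by
  simp only [edgeMatrix, Matrix.of_apply]
  split_ifs
  · rw [norm_mul]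
    gcongr
    linarith
  · nlinarith [norm_nonneg u, norm_nonneg t]
  · rw [norm_zero]
    positivity

theorem PrimeCycle.Rep.cycleWeight_eq {X : UndirectedMultigraph V E} {z : X.PrimeCycle} (B : z.Rep)
    (u t : ℂ) : cycleWeight (X.edgeMatrix u t) B.1 = u ^ z.cbc * t ^ z.length := by
  rw [cycleWeight_edgeMatrix X u t B.isClosedPath, B.cyclicBumpCount_eq, B.length_eq]

variable [Fintype E]

/-- The Euler product converges absolutely near `0`. -/
theorem eventually_zetaConverges (X : UndirectedMultigraph V E) (u : ℂ) :
    ∀ᶠ t in 𝓝 (0 : ℂ), X.ZetaConverges u t := by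
  have hc : Continuous fun t : ℂ => Fintype.card E * ((1 + ‖u‖) * ‖t‖) := by fun_prop
  have h0 := hc.tendsto 0
  simp only [norm_zero, mul_zero] at h0
  filter_upwards [h0.eventually_lt_const one_pos] with t ht
  have hs := summable_cycleWeight (X.norm_edgeMatrix_le u t) (by positivity) ht
  -- One closed path per prime cycle embeds the Euler sum into the summable family over all lists.
  let rep (z : X.PrimeCycle) : z.Rep := Classical.arbitrary _
  have hinj : Function.Injective fun z => (rep z).1 := by
    intro z z' h
    exact Subtype.ext ((rep z).2.symm.trans ((congrArg _ h).trans (rep z').2))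
  exact (hs.comp_injective hinj).congr fun z => by
    rw [Function.comp_apply, (rep z).cycleWeight_eq]

/-- For small `s` the Euler product is the determinant of the edge matrix. -/
theorem exists_hasProd_eq_det (X : UndirectedMultigraph V E) (u t : ℂ) :
    ∃ r > 0, ∀ s : ℂ, ‖s‖ < r →
      HasProd (fun z : X.PrimeCycle => 1 - s ^ z.length * (u ^ z.cbc * t ^ z.length))
        (1 - s • X.edgeMatrix u t).det := by
  obtain ⟨r, hr, hdet⟩ := (X.edgeMatrix u t).exists_hasSum_trace_pow
  set K : ℝ := (1 + ‖u‖) * ‖t‖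
  have hK0 : 0 ≤ K := by positivity
  have hpos : 0 < ((Fintype.card E : ℝ) + 1) * (K + 1) := by positivity
  -- The radius gives both `card E * (‖s‖ * K) < 1`, for summing over lists, and `‖s‖ * K < 1`, for
  -- the logarithms; the latter does not follow from the former if `E` is empty.
  refine ⟨min r (((Fintype.card E : ℝ) + 1) * (K + 1))⁻¹, lt_min hr (inv_pos.mpr hpos),
    fun s hs => ?_⟩
  obtain ⟨a, ha, hda⟩ := hdet s (hs.trans_le (min_le_left _ _))
  have hs1 : ‖s‖ * (((Fintype.card E : ℝ) + 1) * (K + 1)) < 1 := by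
    rw [← lt_inv_mul_iff₀' hpos, mul_one]
    exact hs.trans_le (min_le_right _ _)
  have hE0 : (0 : ℝ) ≤ Fintype.card E := Nat.cast_nonneg _
  have hsE : Fintype.card E * (‖s‖ * K) < 1 := by
    nlinarith [norm_nonneg s, mul_nonneg (norm_nonneg s) hK0, mul_nonneg (norm_nonneg s) hE0]
  have hsK : ‖s‖ * K < 1 := by
    nlinarith [norm_nonneg s, mul_nonneg (norm_nonneg s) hK0, mul_nonneg (norm_nonneg s) hE0,
      mul_nonneg (mul_nonneg (norm_nonneg s) hE0) hK0]
  have hM (e f : E) : ‖(s • X.edgeMatrix u t) e f‖ ≤ ‖s‖ * K := by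
    rw [Matrix.smul_apply, norm_smul]
    exact mul_le_mul_of_nonneg_left (X.norm_edgeMatrix_le u t e f) (norm_nonneg s)
  have hsum := summable_cycleWeight hM (by positivity) hsE
  have h1 := hasSum_cycleWeight_div_length hsum (ha.congr_fun fun n => by
    rw [smul_pow, Matrix.trace_smul, smul_eq_mul])
  rw [← (PrimeCycle.power_injective (X := X)).hasSum_iff (fun C hC => ?_)] at h1
  swap
  · rcases eq_or_ne C [] with rfl | hC0
    · simp
    · have : ¬ X.IsClosedPath C := fun h => hC (PrimeCycle.mem_range_power h)
      rw [cycleWeight_smul, X.cycleWeight_edgeMatrix_of_not_isClosedPath u t hC0 this]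
      simp
  have hx (z : X.PrimeCycle) (B : z.Rep) : cycleWeight (s • X.edgeMatrix u t) B.1 =
      s ^ z.length * (u ^ z.cbc * t ^ z.length) := by
    rw [cycleWeight_smul, B.cycleWeight_eq, B.length_eq]
  have hx1 (z : X.PrimeCycle) : ‖s ^ z.length * (u ^ z.cbc * t ^ z.length)‖ < 1 := by
    obtain ⟨B⟩ : Nonempty z.Rep := inferInstance
    rw [← hx z B]
    refine (norm_cycleWeight_le hM B.1).trans_lt (pow_lt_one₀ (by positivity) hsK ?_)
    rw [B.length_eq]
    exact z.length_pos.ne'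
  -- With `x` the scaled weight of `z`, each `(k + 1)`-st power of a closed path in `z` contributes
  -- `x ^ (k + 1) / ((k + 1) * z.length)`. Summing over the `z.length` closed paths and over `k`
  -- gives `-log (1 - x)`.
  have h2 (z : X.PrimeCycle) : HasSum (fun p : z.Rep × ℕ =>
      cycleWeight (s • X.edgeMatrix u t) (PrimeCycle.power ⟨z, p⟩) /
        (PrimeCycle.power ⟨z, p⟩).length)
      (-Complex.log (1 - s ^ z.length * (u ^ z.cbc * t ^ z.length))) := by
    obtain ⟨ε⟩ := z.exists_equiv_rep
    have : Finite z.Rep := Finite.of_equiv _ ε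
    have hcard : Nat.card z.Rep = z.length := by rw [← Nat.card_congr ε, Nat.card_fin]
    have e (p : z.Rep × ℕ) : cycleWeight (s • X.edgeMatrix u t) (PrimeCycle.power ⟨z, p⟩) /
        (PrimeCycle.power ⟨z, p⟩).length =
        (s ^ z.length * (u ^ z.cbc * t ^ z.length)) ^ (p.2 + 1) / (p.2 + 1) / Nat.card z.Rep := by
      rw [PrimeCycle.power, cycleWeight_flatten_replicate, hx, List.length_flatten_replicate,
        hcard, p.1.length_eq, Nat.cast_mul, div_div, Nat.cast_add, Nat.cast_one]
    have hsz := h1.summable.sigma_factor z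
    refine HasSum.congr_fun (HasSum.const_div_card (Complex.hasSum_taylorSeries_neg_log' (hx1 z))
      (hsz.congr e)) e
  have h3 := (h1.sigma h2).neg
  simp only [neg_neg] at h3
  rw [hda]
  refine Complex.hasProd_of_hasSum_log (fun z h => ?_) h3
  have := hx1 z
  rw [← sub_eq_zero.mp h] at this
  simp at this

/-- The Euler product is the determinant of the edge matrix wherever it converges absolutely. -/
theorem tprod_eq_det (X : UndirectedMultigraph V E) {u t : ℂ} (h : X.ZetaConverges u t) :
    ∏' z : X.PrimeCycle, (1 - u ^ z.cbc * t ^ z.length) = (1 - X.edgeMatrix u t).det := by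
  -- The parameter `s` scales `t`. Absolute convergence at `s = 1` dominates the product on the
  -- closed unit disc, so `F` is continuous there and holomorphic inside. It agrees with the
  -- determinant near `0`, hence on the open disc by the identity theorem, and at the boundary point
  -- `s = 1` by continuity.
  let F (s : ℂ) : ℂ :=
    ∏' z : X.PrimeCycle, (1 + -(s ^ z.length * (u ^ z.cbc * t ^ z.length)))
  have hbound : ∀ s ∈ Metric.closedBall (0 : ℂ) 1, ∀ z : X.PrimeCycle,
      ‖-(s ^ z.length * (u ^ z.cbc * t ^ z.length))‖ ≤ ‖u ^ z.cbc * t ^ z.length‖ := by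
    intro s hs z
    rw [norm_neg, norm_mul, norm_pow]
    exact mul_le_of_le_one_left (norm_nonneg _)
      (pow_le_one₀ (norm_nonneg _) (by simpa using hs))
  have hunif := Summable.hasProdUniformlyOn_one_add (isCompact_closedBall (0 : ℂ) 1) h
    (Eventually.of_forall fun z s hs => hbound s hs z)
    (fun z => by fun_prop)
  have hcont : ContinuousOn F (Metric.closedBall 0 1) :=
    (hasProdUniformlyOn_iff_tendstoUniformlyOn.mp hunif).continuousOn
      (Eventually.frequently (Eventually.of_forall fun I => by fun_prop))
  have hdiff : DifferentiableOn ℂ F (Metric.ball 0 1) :=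
    ((hasProdUniformlyOn_iff_tendstoUniformlyOn.mp hunif).mono
      Metric.ball_subset_closedBall).tendstoLocallyUniformlyOn.differentiableOn
      (Eventually.of_forall fun I => by fun_prop) Metric.isOpen_ball
  have hdet : ∀ s : ℂ, (1 - s • X.edgeMatrix u t).det =
      (((X.edgeMatrix u t).charpoly.roots.map fun a => 1 - s * a).prod) :=
    fun s => Matrix.det_one_sub_smul_eq_prod_roots _ s
  have hG : Differentiable ℂ fun s : ℂ => (1 - s • X.edgeMatrix u t).det := by
    simp only [hdet]
    induction (X.edgeMatrix u t).charpoly.roots using Multiset.induction_on with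
    | empty => simp
    | cons a m ih =>
      simp only [Multiset.map_cons, Multiset.prod_cons]
      exact Differentiable.mul (by fun_prop) ih
  obtain ⟨r, hr, hsmall⟩ := X.exists_hasProd_eq_det u t
  have hev : F =ᶠ[𝓝 0] fun s : ℂ => (1 - s • X.edgeMatrix u t).det := by
    filter_upwards [Metric.ball_mem_nhds (0 : ℂ) hr] with s hs
    simp only [F, ← sub_eq_add_neg]
    exact (hsmall s (by simpa using hs)).tprod_eq
  have hball : Set.EqOn F (fun s : ℂ => (1 - s • X.edgeMatrix u t).det) (Metric.ball 0 1) :=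
    (hdiff.analyticOnNhd Metric.isOpen_ball).eqOn_of_preconnected_of_eventuallyEq
      (hG.differentiableOn.analyticOnNhd Metric.isOpen_ball)
      (convex_ball (0 : ℂ) 1).isPreconnected (Metric.mem_ball_self one_pos) hev
  have hclosed := hball.of_subset_closure hcont hG.continuous.continuousOn
    Metric.ball_subset_closedBall (closure_ball (0 : ℂ) one_ne_zero).symm.subset
  have := hclosed (show (1 : ℂ) ∈ Metric.closedBall 0 1 by simp)
  simpa [F, ← sub_eq_add_neg] using this

/-- If a factor vanishes, the determinant is `0` and the convention `0⁻¹ = 0` makes both sides `0`.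
Otherwise absolute convergence keeps the product away from `0`, so it may be inverted. -/
theorem hasProd_zeta (X : UndirectedMultigraph V E) {u t : ℂ} (h : X.ZetaConverges u t) :
    HasProd (fun z : X.PrimeCycle => (1 - u ^ z.cbc * t ^ z.length)⁻¹)
      (1 - X.edgeMatrix u t).det⁻¹ := by
  have hm : Multipliable fun z : X.PrimeCycle => 1 - u ^ z.cbc * t ^ z.length := by
    simp only [sub_eq_add_neg]
    exact multipliable_one_add_of_summable (by simpa [ZetaConverges] using h)
  have hp := hm.hasProd
  rw [X.tprod_eq_det h] at hp
  by_cases h0 : ∃ z : X.PrimeCycle, 1 - u ^ z.cbc * t ^ z.length = 0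
  · obtain ⟨z, hz⟩ := h0
    rw [hp.unique (hasProd_zero_of_exists_eq_zero ⟨z, hz⟩), inv_zero]
    exact hasProd_zero_of_exists_eq_zero ⟨z, by rw [hz, inv_zero]⟩
  · push Not at h0
    refine hp.inv₀ ?_
    rw [← X.tprod_eq_det h]
    simp only [sub_eq_add_neg] at h0 ⊢
    exact tprod_one_add_ne_zero_of_summable h0 (by simpa [ZetaConverges] using h)

end UndirectedMultigraph

theorem corollary5p2 {V E ι : Type*} [Fintype V] [DecidableEq V] [Fintype E] [DecidableEq E]
    [Fintype ι] [DecidableEq ι] (X : UndirectedMultigraph V E)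
    (c : V → ι) (hc : X.IsEquitable c) (w : ι → V) (hw : ∀ i, c (w i) = i) :
    (∀ (α : ℂ) (D : Matrix V V ℂ) (d : ι → ℂ), D.IsDiag → (∀ v, D v v = d (c v)) →
      (α • X.adjMatrix ℂ + D).charpoly =
        (α • (MultiDigraph.quotientGraph hc).adjMatrix ℂ + Matrix.diagonal d).charpoly *
        (α • (X.deletionGraph c w).adjMatrix ℂ + D.restrictRemaining w).charpoly) ∧
    X.laplacian.charpoly =
      (-(MultiDigraph.quotientGraph hc).adjMatrix ℂ
        + (MultiDigraph.quotientGraph hc).degMatrix).charpoly *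
      (-(X.deletionGraph c w).adjMatrix ℂ + X.degMatrix.restrictRemaining w).charpoly ∧
    X.signlessLaplacian.charpoly =
      ((MultiDigraph.quotientGraph hc).adjMatrix ℂ
        + (MultiDigraph.quotientGraph hc).degMatrix).charpoly *
      ((X.deletionGraph c w).adjMatrix ℂ + X.degMatrix.restrictRemaining w).charpoly ∧
    ((∀ e, X.inv e ≠ e) → ∀ u : ℂ,
      (∀ᶠ t in 𝓝 (0 : ℂ), X.ZetaConverges u t) ∧
      ∀ t : ℂ, X.ZetaConverges u t →
        (1 - (1 - u) ^ 2 * t ^ 2 ≠ 0 ∨ Fintype.card V ≤ X.numEdges) →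
        Multipliable (fun z : X.PrimeCycle => (1 - u ^ z.cbc * t ^ z.length)⁻¹) ∧
        (X.zeta u t)⁻¹ =
          (1 - (1 - u) ^ 2 * t ^ 2) ^ ((X.numEdges : ℤ) - (Fintype.card V : ℤ)) *
          (-t • (MultiDigraph.quotientGraph hc).adjMatrix ℂ
            + (MultiDigraph.quotientGraph hc).zetaDegMatrix u t).det *
          (-t • (X.deletionGraph c w).adjMatrix ℂ
            + (X.zetaDegMatrix u t).restrictRemaining w).det) := by
  have hdeg : ∀ v, X.degMatrix v v = ((MultiDigraph.quotientGraph hc).degree (c v) : ℂ) :=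
    fun v => by rw [MultiDigraph.degMatrix, Matrix.diagonal_apply_eq, hc.degree_eq]
  have hdiag : X.degMatrix.IsDiag := Matrix.isDiag_diagonal _
  refine ⟨fun α D d hD hd => hc.charpoly_eq hw α hD hd, ?_, ?_, fun h u =>
    ⟨X.eventually_zetaConverges u, fun t ht hs => ⟨(X.hasProd_zeta ht).multipliable, ?_⟩⟩⟩
  · simpa only [neg_smul, one_smul] using! hc.charpoly_eq hw (-1) hdiag hdeg
  · simpa only [one_smul] using! hc.charpoly_eq hw 1 hdiag hdeg
  -- The zeta degree matrix of the quotient is put in the form `diagonal d` to match the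
  -- factorization.
  · have hZ : (MultiDigraph.quotientGraph hc).zetaDegMatrix u t = Matrix.diagonal fun i =>
        (1 - (1 - u) ^ 2 * t ^ 2) +
          ((1 - u) * t ^ 2) * ((MultiDigraph.quotientGraph hc).degree i : ℂ) := by
      rw [MultiDigraph.zetaDegMatrix, MultiDigraph.degMatrix, Matrix.smul_one_eq_diagonal,
        ← Matrix.diagonal_smul, Matrix.diagonal_add]
      rfl
    rw [UndirectedMultigraph.zeta, (X.hasProd_zeta ht).tprod_eq, inv_inv,
      X.det_one_sub_edgeMatrix h u t hs, mul_assoc, hZ]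
    congr 1
    refine hc.det_eq hw (-t) ?_ fun v => ?_
    · exact (Matrix.isDiag_one.smul _).add (hdiag.smul _)
    · rw [MultiDigraph.zetaDegMatrix, Matrix.add_apply, Matrix.smul_apply, Matrix.smul_apply, hdeg,
        Matrix.one_apply_eq, smul_eq_mul, smul_eq_mul, mul_one]
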